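/- For $n\in\mathbb N$ and $\mathbf x,\mathbf y\in\{0,1\}^n$ let $|\mathbf x|$ be the Hamming weight and $\Delta(\mathbf x,\mathbf y)$ the Hamming distance. For natural numbers $n,a,b,c,g$ let $\mathrm{exact\text{-}GHD}^n_{a,b,c,g}:\{0,1\}^n\times\{0,1\}^n\to\{0,1,?\}$ be the partial function that, for $|\mathbf x|=a$ and $|\mathbf y|=b$, equals $1$ if $\Delta(\mathbf x,\mathbf y)=c+g$ and $0$ if $\Delta(\mathbf x,\mathbf y)=c-g$, and that is undefined ($?$) in all other cases. The parameters are called meaningful if $g\ge 1$, $a,b\le n$, and both $c+g$ and $c-g$ are Hamming distances $\Delta(\mathbf x,\mathbf y)$ of some $\mathbf x,\mathbf y\in\{0,1\}^n$ with $|\mathbf x|=a$, $|\mathbf y|=b$. For a partial function $f:\{0,1\}^n\times\{0,1\}^n\to\{0,1,?\}$ let $R^{\text{1-way}}(f)$ be the least $k$ for which there is a public-coin randomized protocol in which Alice, given $\mathbf x$, sends a single message of $k$ bits to Bob, and Bob, given $\mathbf y$ and the message, outputs a bit, such that on every $(\mathbf x,\mathbf y)$ with $f(\mathbf x,\mathbf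 y)\neq{?}$ the output equals $f(\mathbf x,\mathbf y)$ with probability at least $2/3$. **Lemma.** There is a universal constant $C>0$ such that for all meaningful $n,a,b,c,g$, $$R^{\text{1-way}}(\mathrm{exact\text{-}GHD}^n_{a,b,c,g})\ \ge\ \frac1C\cdot\frac{\min\{a,\,n-a,\,c,\,n-c\}}{g}$$ and $$R^{\text{1-way}}(\mathrm{exact\text{-}GHD}^n_{a,b,c,g})\ \ge\ \frac1C\cdot\log_2\left(\frac{\min\{c,\,n-c\}}{g}\right).$$ -/

import Mathlib

open MeasureTheory

/-- Binary strings of length `n`. -/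
abbrev BitStr (n : ℕ) : Type := Fin n → Bool

/-- The Hamming weight `|x|`: the number of coordinates of `x` that are equal to `1`. The Hamming
distance is Mathlib's `hammingDist`. -/
def hammingWeight {n : ℕ} (x : BitStr n) : ℕ :=
  (Finset.univ.filter fun i => x i = true).card

/-- A one-way communication protocol with public randomness in which Alice sends `k` bits to Bob.
A random `ω` is drawn from a probability space and seen by both parties. Alice computes her message
from `ω` and her input, Bob computes the output from `ω`, the message and his input. Both
computations depend measurably on `ω`. The communication cost of the protocol is `k`. -/
structure OneWayProtocol (n k : ℕ) where
  /-- the space of the public randomness -/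
  Ω : Type
  [mΩ : MeasurableSpace Ω]
  /-- the law of the public randomness -/
  P : Measure Ω
  [isProb : IsProbabilityMeasure P]
  /-- Alice's message -/
  message : Ω → BitStr n → BitStr k
  measurable_message : ∀ x, Measurable fun ω => message ω x
  /-- Bob's output -/
  output : Ω → BitStr k → BitStr n → Bool
  measurable_output : ∀ m y, Measurable fun ω => output ω m y

attribute [instance] OneWayProtocol.mΩ OneWayProtocol.isProb

/-- The output of the protocol on the input pair `(x, y)` when the public randomness is `ω`. -/
def OneWayProtocol.run {n k : ℕ} (π : OneWayProtocol n k) (x y : BitStr n) (ω : π.Ω) : Bool :=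
  π.output ω (π.message ω x) y

/-- The protocol computes the partial function `f` (where `none` stands for the undefined value
`?`): on every input pair on which `f` is defined, the output is correct with probability at least
`2/3`. -/
def OneWayProtocol.Computes {n k : ℕ} (π : OneWayProtocol n k)
    (f : BitStr n → BitStr n → Option Bool) : Prop :=
  ∀ (x y : BitStr n) (v : Bool), f x y = some v → (2 / 3 : ℝ) ≤ π.P.real {ω | π.run x y ω = v}

/-- The one-way randomized communication complexity of a partial function `f`: the least cost of a
one-way public-coin protocol (only Alice speaks) that computes `f`. -/
noncomputable def oneWayCC {n : ℕ} (f : BitStr n → BitStr n → Option Bool) : ℕ :=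
  sInf {k : ℕ | ∃ π : OneWayProtocol n k, π.Computes f}

/-- The minimum that defines `oneWayCC` is over a nonempty set: Alice can send her whole input. -/
theorem oneWayCC_set_nonempty {n : ℕ} (f : BitStr n → BitStr n → Option Bool) :
    {k : ℕ | ∃ π : OneWayProtocol n k, π.Computes f}.Nonempty := by
  refine ⟨n, ⟨Unit, Measure.dirac (), fun _ x => x, fun _ => measurable_const,
    fun _ m y => (f m y).getD false, fun _ _ => measurable_const⟩, ?_⟩
  intro x y v hv
  simp [OneWayProtocol.run, hv]
  norm_num

/-- The partial function exact Gap-Hamming-Distance with parameters `n, a, b, c, g`: for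
`|x| = a` and `|y| = b` it is `1` if `Δ(x, y) = c + g` and `0` if `Δ(x, y) = c - g` (subtraction in
the integers), and it is undefined otherwise. -/
def exactGHD (n a b c g : ℕ) (x y : BitStr n) : Option Bool :=
  if hammingWeight x = a ∧ hammingWeight y = b then
    if (hammingDist x y : ℤ) = (c : ℤ) + g then some true
    else if (hammingDist x y : ℤ) = (c : ℤ) - g then some false
    else none
  else none

/-- The parameters are meaningful: the gap `g` is positive, `a, b ≤ n`, and both `c + g` and
`c - g` are Hamming distances of strings of length `n` and weights `a` and `b`. -/
def MeaningfulGHD (n a b c g : ℕ) : Prop :=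
  0 < g ∧ a ≤ n ∧ b ≤ n ∧
  (∃ x y : BitStr n, hammingWeight x = a ∧ hammingWeight y = b ∧
    (hammingDist x y : ℤ) = (c : ℤ) + g) ∧
  (∃ x y : BitStr n, hammingWeight x = a ∧ hammingWeight y = b ∧
    (hammingDist x y : ℤ) = (c : ℤ) - g)

/-!
The index problem on `m` bits costs Alice `Ω(m)` bits: a good protocol is, for a suitable value of
the public randomness, a code with `2 ^ k` codewords that approximates the strings of length `m`
with average relative error `1 / 3`.

Only the joint type of `x` and `y` (how often each of the four pairs of bits occurs) matters for
exact-GHD. Strings at distances `c - g` and `c + g` differ in type by moving `g` coordinates from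
each of `(1, 1)` and `(0, 0)` to each of `(1, 0)` and `(0, 1)`, so meaningful parameters amount to
the numbers `A`, `B`, `D`, `E` of the remaining pairs `(1, 1)`, `(1, 0)`, `(0, 1)`, `(0, 0)`.
Repeating every bit of an index instance `g` times embeds the index problem on about `min B E / g`
bits, and complementing Bob's string does the same with `min A D / g` bits. If both minima are at
most `t`, then one of `a`, `n - a`, `c`, `n - c` is at most `2 * t + g`.

For the logarithmic bound, let Bob send the table of his answers to all `2 ^ k` messages of Alice.
The bound already proved, applied to this protocol, gives `min {b, n - b, c, n - c} = O(2 ^ k * g)`,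
and by the triangle inequality `min {c, n - c}` is at most the sum of `min {a, n - a, c, n - c}` and
`min {b, n - b, c, n - c}`.
-/

section HammingDist

variable {ι κ α : Type*} [Fintype ι] [Fintype κ] [DecidableEq α]

theorem hammingDist_comp_equiv (e : κ ≃ ι) (u v : ι → α) :
    hammingDist (u ∘ e) (v ∘ e) = hammingDist u v := by
  simp only [hammingDist, Finset.card_filter, Function.comp_apply]
  exact e.sum_comp fun i => if u i ≠ v i then 1 else 0

theorem hammingDist_sum_type (u v : ι ⊕ κ → α) :
    hammingDist u v =
      hammingDist (u ∘ Sum.inl) (v ∘ Sum.inl) + hammingDist (u ∘ Sum.inr) (v ∘ Sum.inr) := by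
  simp only [hammingDist, Finset.card_filter, Fintype.sum_sum_type, Function.comp_apply]

theorem hammingDist_comp_fst (u v : ι → α) :
    hammingDist (fun p : ι × κ => u p.1) (fun p => v p.1) =
      hammingDist u v * Fintype.card κ := by
  rw [hammingDist, hammingDist, ← Finset.card_univ, ← Finset.card_product]
  congr 1
  ext p
  simp

theorem hammingDist_const (a b : α) :
    hammingDist (fun _ : ι => a) (fun _ => b) = if a = b then 0 else Fintype.card ι := by
  split_ifs with h <;> simp [hammingDist, h]

theorem hammingDist_update_right [DecidableEq ι] (x y : ι → α) (i : ι) (b : α) :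
    hammingDist x (Function.update y i b) + (if x i ≠ y i then 1 else 0) =
      hammingDist x y + if x i ≠ b then 1 else 0 := by
  simp only [hammingDist, Finset.card_filter]
  rw [← Finset.add_sum_erase _ _ (Finset.mem_univ i),
    ← Finset.add_sum_erase _ (fun j => if x j ≠ y j then 1 else 0) (Finset.mem_univ i),
    Function.update_self, Finset.sum_congr rfl fun j hj => by
      rw [Function.update_of_ne (Finset.ne_of_mem_erase hj)]]
  ring

theorem hammingDist_add_hammingDist_not (x y : ι → Bool) :
    hammingDist x y + hammingDist x (fun i => !y i) = Fintype.card ι := by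
  have hne : ∀ i, (x i ≠ !y i) ↔ ¬ x i ≠ y i := fun i => by cases x i <;> cases y i <;> simp
  simp only [hammingDist, hne]
  exact Finset.card_filter_add_card_filter_not _

theorem sum_pow_hammingDist [DecidableEq ι] [Fintype α] {R : Type*} [CommRing R] (t : R)
    (w : ι → α) :
    ∑ z, t ^ hammingDist z w = (1 + (Fintype.card α - 1) * t) ^ Fintype.card ι := by
  have hsum (b : α) : ∑ a, (if a ≠ b then t else 1) = 1 + (Fintype.card α - 1) * t := by
    have hcard : ((Finset.univ.erase b).card : R) = Fintype.card α - 1 := by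
      rw [Finset.cast_card_erase_of_mem (Finset.mem_univ b), Finset.card_univ]
    rw [← Finset.add_sum_erase _ _ (Finset.mem_univ b), if_neg (not_not.2 rfl),
      Finset.sum_congr rfl fun a ha => if_pos (Finset.ne_of_mem_erase ha), Finset.sum_const,
      nsmul_eq_mul, hcard]
  calc ∑ z, t ^ hammingDist z w
      = ∑ z : ι → α, ∏ i, if z i ≠ w i then t else 1 :=
        Finset.sum_congr rfl fun z _ => by simp [hammingDist, Finset.prod_ite]
    _ = ∏ i, ∑ a, if a ≠ w i then t else 1 :=
        (Fintype.prod_sum fun i a => if a ≠ w i then t else 1).symm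
    _ = (1 + (Fintype.card α - 1) * t) ^ Fintype.card ι := by
        simp only [hsum, Finset.prod_const, Finset.card_univ]

end HammingDist

section Code

theorem card_mul_rpow_le_sum_rpow {ι : Type*} [Fintype ι] {N : ι → ℝ} {s t : ℝ} (ht : 0 < t)
    (ht₁ : t ≤ 1) (h : ∑ z, N z ≤ Fintype.card ι * s) :
    Fintype.card ι * t ^ s ≤ ∑ z, t ^ N z := by
  rcases isEmpty_or_nonempty ι with _ | _
  · simp
  have hcard : (0 : ℝ) < Fintype.card ι := by exact_mod_cast Fintype.card_pos
  have jensen : t ^ (∑ z, (Fintype.card ι : ℝ)⁻¹ • N z) ≤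
      ∑ z, (Fintype.card ι : ℝ)⁻¹ • t ^ N z :=
    (convexOn_rpow_left ht).map_sum_le (fun _ _ => (inv_pos.2 hcard).le)
      (by simp [hcard.ne']) fun _ _ => Set.mem_univ _
  rw [← Finset.smul_sum, ← Finset.smul_sum, smul_eq_mul, smul_eq_mul, inv_mul_eq_div,
    inv_mul_eq_div] at jensen
  calc Fintype.card ι * t ^ s
      ≤ Fintype.card ι * t ^ ((∑ z, N z) / Fintype.card ι) := by
        gcongr ?_ * ?_
        exact Real.rpow_le_rpow_of_exponent_ge ht ht₁ ((div_le_iff₀' hcard).2 h)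
    _ ≤ ∑ z, t ^ N z := (le_div_iff₀' hcard).1 jensen

theorem card_mul_rpow_le_of_sum_hammingDist_le {ι κ α : Type*} [Fintype ι] [DecidableEq ι]
    [Fintype κ] [Fintype α] [DecidableEq α] (encode : (ι → α) → κ) (decode : κ → ι → α)
    {s t : ℝ} (ht : 0 < t) (ht₁ : t ≤ 1)
    (h : ∑ z, (hammingDist z (decode (encode z)) : ℝ) ≤ Fintype.card (ι → α) * s) :
    Fintype.card (ι → α) * t ^ s ≤
      Fintype.card κ * (1 + (Fintype.card α - 1) * t) ^ Fintype.card ι := by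
  calc Fintype.card (ι → α) * t ^ s
      ≤ ∑ z, t ^ (hammingDist z (decode (encode z)) : ℝ) := card_mul_rpow_le_sum_rpow ht ht₁ h
    _ ≤ ∑ z, ∑ μ, t ^ hammingDist z (decode μ) := by
        simp only [Real.rpow_natCast]
        exact Finset.sum_le_sum fun z _ =>
          Finset.single_le_sum (f := fun μ => t ^ hammingDist z (decode μ))
            (fun _ _ => by positivity) (Finset.mem_univ _)
    _ = Fintype.card κ * (1 + (Fintype.card α - 1) * t) ^ Fintype.card ι := by
        rw [Finset.sum_comm]
        simp only [sum_pow_hammingDist, Finset.sum_const, Finset.card_univ, nsmul_eq_mul]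

theorem le_mul_of_sum_hammingDist_le_third {m k : ℕ} (encode : BitStr m → BitStr k)
    (decode : BitStr k → BitStr m)
    (h : ∑ z, (hammingDist z (decode (encode z)) : ℝ) ≤ 2 ^ m * (m / 3)) : m ≤ 15 * k := by
  have hcode : (2 : ℝ) ^ m * (1 / 2) ^ (m / 3 : ℝ) ≤ 2 ^ k * (3 / 2) ^ m := by
    -- The choice `t = δ / (1 - δ)` is optimal at relative error `δ = 1 / 3`.
    have := card_mul_rpow_le_of_sum_hammingDist_le encode decode (s := m / 3) (t := 1 / 2)
      (by norm_num) (by norm_num) (by simpa using h)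
    norm_num at this ⊢
    exact this
  have hthird : ((1 / 2 : ℝ) ^ (m / 3 : ℝ)) ^ 3 = (1 / 2) ^ m := by
    rw [← Real.rpow_natCast, ← Real.rpow_mul (by norm_num), ← Real.rpow_natCast]
    norm_num
  have hcube : (32 / 27 : ℝ) ^ m ≤ 8 ^ k := by
    have hpow := pow_le_pow_left₀ (by positivity) hcode 3
    rw [mul_pow, mul_pow, hthird, pow_right_comm, pow_right_comm (2 : ℝ) k,
      pow_right_comm (3 / 2 : ℝ), ← mul_pow] at hpow
    calc (32 / 27 : ℝ) ^ m = (2 ^ 3 * (1 / 2)) ^ m / ((3 / 2) ^ 3) ^ m := by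
          rw [← div_pow]; norm_num
      _ ≤ (2 ^ 3) ^ k := (div_le_iff₀ (by positivity)).2 hpow
      _ = 8 ^ k := by norm_num
  have hbase : (8 : ℝ) ^ k ≤ (32 / 27) ^ (15 * k) := by
    rw [pow_mul]
    exact pow_le_pow_left₀ (by norm_num) (by norm_num) k
  exact (pow_le_pow_iff_right₀ (by norm_num)).1 (hcube.trans hbase)

end Code

section Protocol

theorem exists_sum_indicator_le_sum_measureReal {Ω ι : Type*} [MeasurableSpace Ω] [Fintype ι]
    (P : Measure Ω) [IsProbabilityMeasure P] {S : ι → Set Ω} (hS : ∀ i, MeasurableSet (S i)) :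
    ∃ ω, ∑ i, (S i).indicator (1 : Ω → ℝ) ω ≤ ∑ i, P.real (S i) := by
  have hint : ∀ i ∈ Finset.univ, Integrable ((S i).indicator (1 : Ω → ℝ)) P := fun i _ =>
    (integrable_const (1 : ℝ)).indicator (hS i)
  obtain ⟨ω, hω⟩ := exists_le_integral (integrable_finsetSum _ hint)
  rw [integral_finsetSum _ hint] at hω
  simp only [integral_indicator_one (hS _)] at hω
  exact ⟨ω, hω⟩

variable {n m k : ℕ} {f : BitStr n → BitStr n → Option Bool} {π : OneWayProtocol n k}

theorem OneWayProtocol.measurableSet_run_eq (π : OneWayProtocol n k) (x y : BitStr n)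
    (v : Bool) : MeasurableSet {ω | π.run x y ω = v} := by
  have hunion : {ω | π.run x y ω = v} =
      ⋃ μ : BitStr k, {ω | π.message ω x = μ} ∩ {ω | π.output ω μ y = v} := by
    ext ω
    simp [OneWayProtocol.run]
  rw [hunion]
  exact MeasurableSet.iUnion fun μ =>
    (π.measurable_message x (measurableSet_singleton μ)).inter
      (π.measurable_output μ y (measurableSet_singleton v))

theorem OneWayProtocol.Computes.measureReal_compl_run_eq_le (h : π.Computes f) {x y : BitStr n}
    {v : Bool} (hv : f x y = some v) : π.P.real {ω | π.run x y ω = v}ᶜ ≤ 1 / 3 := by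
  have hcompl := probReal_compl_eq_one_sub (μ := π.P) (π.measurableSet_run_eq x y v)
  linarith [h x y v hv]

/-- The protocol for the problem with exchanged inputs in which the sender, now holding Bob's
input, sends the table of Bob's answers to all `2 ^ k` messages of Alice. -/
noncomputable def OneWayProtocol.transpose (π : OneWayProtocol n k) : OneWayProtocol n (2 ^ k) :=
  let e : Fin (2 ^ k) ≃ BitStr k := Fintype.equivOfCardEq (by simp)
  { Ω := π.Ω
    P := π.P
    message := fun ω y j => π.output ω (e j) y
    measurable_message := fun y => measurable_pi_lambda _ fun j => π.measurable_output (e j) y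
    output := fun ω table x => table (e.symm (π.message ω x))
    measurable_output := fun table x =>
      (Measurable.of_discrete (f := fun μ => table (e.symm μ))).comp (π.measurable_message x) }

theorem OneWayProtocol.Computes.transpose (h : π.Computes f) :
    π.transpose.Computes fun x y => f y x := by
  intro x y v hv
  have hrun : π.transpose.run x y = π.run y x := by
    funext ω
    simp [OneWayProtocol.run, OneWayProtocol.transpose]
  rw [hrun]
  exact h y x v hv

theorem exists_computes_oneWayCC (f : BitStr n → BitStr n → Option Bool) :
    ∃ π : OneWayProtocol n (oneWayCC f), π.Computes f :=
  Nat.sInf_mem (oneWayCC_set_nonempty f)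

theorem oneWayCC_swap_le_two_pow (f : BitStr n → BitStr n → Option Bool) :
    oneWayCC (fun x y => f y x) ≤ 2 ^ oneWayCC f := by
  obtain ⟨π, hπ⟩ := exists_computes_oneWayCC f
  exact Nat.sInf_le ⟨π.transpose, hπ.transpose⟩

/-- The index problem on `m` bits (Alice holds `z`, Bob holds `i` and has to find `z i`) is a
restriction of `f`, up to renaming the inputs of each player. -/
def IndexEmbeds (m : ℕ) (f : BitStr n → BitStr n → Option Bool) : Prop :=
  ∃ (X : BitStr m → BitStr n) (Y : Fin m → BitStr n), ∀ z i, f (X z) (Y i) = some (z i)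

theorem IndexEmbeds.le_of_computes (hf : IndexEmbeds m f) (hπ : π.Computes f) : m ≤ 15 * k := by
  obtain ⟨X, Y, hXY⟩ := hf
  let err : BitStr m × Fin m → Set π.Ω := fun p => {ω | π.run (X p.1) (Y p.2) ω = p.1 p.2}ᶜ
  obtain ⟨ω, hω⟩ := exists_sum_indicator_le_sum_measureReal π.P (S := err) fun p =>
    (π.measurableSet_run_eq _ _ _).compl
  refine le_mul_of_sum_hammingDist_le_third (fun z => π.message ω (X z))
    (fun μ i => π.output ω μ (Y i)) ?_
  calc ∑ z, (hammingDist z (fun i => π.output ω (π.message ω (X z)) (Y i)) : ℝ)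
      = ∑ p, (err p).indicator (1 : π.Ω → ℝ) ω := by
        simp [err, hammingDist, Finset.natCast_card_filter, Fintype.sum_prod_type,
          Set.indicator_apply, OneWayProtocol.run, eq_comm]
    _ ≤ ∑ p, π.P.real (err p) := hω
    _ ≤ ∑ _p : BitStr m × Fin m, (1 / 3 : ℝ) :=
        Finset.sum_le_sum fun p _ => hπ.measureReal_compl_run_eq_le (hXY p.1 p.2)
    _ = 2 ^ m * (m / 3) := by
        simp [div_eq_mul_inv, mul_assoc]

theorem IndexEmbeds.le_oneWayCC (hf : IndexEmbeds m f) : m ≤ 15 * oneWayCC f := by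
  obtain ⟨π, hπ⟩ := exists_computes_oneWayCC f
  exact hf.le_of_computes hπ

end Protocol

section JointType

theorem hammingWeight_eq_hammingDist_false {n : ℕ} (x : BitStr n) :
    hammingWeight x = hammingDist x fun _ => false := by
  simp [hammingWeight, hammingDist]

theorem hammingWeight_comp_equiv {n : ℕ} {ι : Type*} [Fintype ι] (e : Fin n ≃ ι)
    (u : ι → Bool) : hammingWeight (u ∘ e) = hammingDist u fun _ => false := by
  rw [hammingWeight_eq_hammingDist_false]
  exact hammingDist_comp_equiv e u fun _ => false

theorem hammingWeight_add_hammingWeight_not {n : ℕ} (x : BitStr n) :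
    hammingWeight x + hammingWeight (fun i => !x i) = n := by
  rw [hammingWeight_eq_hammingDist_false, hammingWeight_eq_hammingDist_false, hammingDist_comm,
    hammingDist_comm (fun i => !x i), hammingDist_add_hammingDist_not, Fintype.card_fin]

/-- The joint type of `x` and `y`: the pairs of bits `(1, 1)`, `(1, 0)`, `(0, 1)`, `(0, 0)` occur
`p`, `q`, `r`, `s` times in the sequence of pairs `(x i, y i)`. It is recorded through the length,
the two weights and the distance, which determine these four numbers. -/
structure HasJointType {n : ℕ} (x y : BitStr n) (p q r s : ℕ) : Prop where
  length_eq : n = p + q + r + s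
  weight_left : hammingWeight x = p + q
  weight_right : hammingWeight y = p + r
  dist_eq : hammingDist x y = q + r

theorem exists_hasJointType {n : ℕ} (x y : BitStr n) :
    ∃ p q r s : ℕ, HasJointType x y p q r s := by
  refine ⟨∑ i, (x i && y i).toNat, ∑ i, (x i && !y i).toNat, ∑ i, (!x i && y i).toNat,
    ∑ i, (!x i && !y i).toNat, ?_, ?_, ?_, ?_⟩
  · simp only [← Finset.sum_add_distrib]
    conv_lhs => rw [← Fintype.card_fin n, Fintype.card_eq_sum_ones]
    refine Finset.sum_congr rfl fun i _ => ?_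
    cases x i <;> cases y i <;> rfl
  all_goals
    simp only [hammingWeight, hammingDist, Finset.card_filter, ← Finset.sum_add_distrib]
    refine Finset.sum_congr rfl fun i _ => ?_
    cases x i <;> cases y i <;> rfl

theorem exists_bitStr_hasJointType (p q r s : ℕ) :
    ∃ x y : BitStr (p + q + r + s), HasJointType x y p q r s := by
  let e : Fin (p + q + r + s) ≃ ((Fin p ⊕ Fin q) ⊕ Fin r) ⊕ Fin s :=
    Fintype.equivOfCardEq (by simp)
  let u : ((Fin p ⊕ Fin q) ⊕ Fin r) ⊕ Fin s → Bool :=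
    Sum.elim (Sum.elim (Sum.elim (fun _ => true) fun _ => true) fun _ => false) fun _ => false
  let v : ((Fin p ⊕ Fin q) ⊕ Fin r) ⊕ Fin s → Bool :=
    Sum.elim (Sum.elim (Sum.elim (fun _ => true) fun _ => false) fun _ => true) fun _ => false
  refine ⟨u ∘ e, v ∘ e, rfl, ?_, ?_, ?_⟩
  all_goals
    simp only [u, v, hammingWeight_comp_equiv, hammingDist_comp_equiv, hammingDist_sum_type]
    simp [Function.comp_def, hammingDist_const]

end JointType

section ExactGHD

theorem exactGHD_swap (n a b c g : ℕ) :
    (fun x y => exactGHD n a b c g y x) = exactGHD n b a c g := by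
  funext x y
  simp only [exactGHD, hammingDist_comm y x, and_comm]

theorem exactGHD_not_right {n a b b' c c' g : ℕ} (hg : 0 < g) (hb : b + b' = n)
    (hc : c + c' = n) (x y : BitStr n) :
    exactGHD n a b' c' g x (fun i => !y i) = (exactGHD n a b c g x y).map not := by
  have hweight := hammingWeight_add_hammingWeight_not y
  have hdist := hammingDist_add_hammingDist_not x y
  rw [Fintype.card_fin] at hdist
  unfold exactGHD
  split_ifs <;> first | rfl | omega

theorem IndexEmbeds.exactGHD_compl {n a b b' c c' g m : ℕ} (hg : 0 < g) (hb : b + b' = n)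
    (hc : c + c' = n) (h : IndexEmbeds m (exactGHD n a b c g)) :
    IndexEmbeds m (exactGHD n a b' c' g) := by
  obtain ⟨X, Y, hXY⟩ := h
  refine ⟨fun z => X fun i => !z i, fun i j => !Y i j, fun z i => ?_⟩
  rw [exactGHD_not_right hg hb hc, hXY]
  simp

section Gadget

variable {m g r n : ℕ}

/-- The string in which every bit of `w₁` and of `w₂` is repeated `g` times and to which the padding
`u` is appended. The order of the coordinates is immaterial and given by an arbitrary bijection. -/
def blockString (e : Fin n ≃ ((Fin m × Fin g) ⊕ (Fin m × Fin g)) ⊕ Fin r) (w₁ w₂ : BitStr m)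
    (u : BitStr r) : BitStr n :=
  Sum.elim (Sum.elim (fun p => w₁ p.1) fun p => w₂ p.1) u ∘ e

variable (e : Fin n ≃ ((Fin m × Fin g) ⊕ (Fin m × Fin g)) ⊕ Fin r)

theorem hammingDist_blockString (w₁ w₂ w₁' w₂' : BitStr m) (u u' : BitStr r) :
    hammingDist (blockString e w₁ w₂ u) (blockString e w₁' w₂' u') =
      hammingDist w₁ w₁' * g + hammingDist w₂ w₂' * g + hammingDist u u' := by
  have hrepeat (w w' : BitStr m) :
      hammingDist (fun p : Fin m × Fin g => w p.1) (fun p => w' p.1) = hammingDist w w' * g := by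
    rw [hammingDist_comp_fst, Fintype.card_fin]
  rw [blockString, blockString, hammingDist_comp_equiv, hammingDist_sum_type,
    hammingDist_sum_type, ← hrepeat, ← hrepeat]
  rfl

theorem hammingWeight_blockString (w₁ w₂ : BitStr m) (u : BitStr r) :
    hammingWeight (blockString e w₁ w₂ u) =
      hammingWeight w₁ * g + hammingWeight w₂ * g + hammingWeight u := by
  have hfalse : (fun _ => false) =
      blockString e (fun _ => false) (fun _ => false) (fun _ => false) := by
    funext j
    rw [blockString, Function.comp_apply]
    rcases e j with (_ | _) | _ <;> rfl
  simp only [hammingWeight_eq_hammingDist_false]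
  rw [hfalse, hammingDist_blockString]

theorem hammingWeight_update_false (i : Fin m) :
    hammingWeight (Function.update (fun _ => false) i true) = 1 := by
  simp [hammingWeight, Function.update_apply, Finset.filter_eq']

theorem hammingWeight_add_hammingDist_not_update (z : BitStr m) (i : Fin m) :
    hammingWeight z + hammingDist (fun j => !z j) (Function.update (fun _ => false) i true) + 1 =
      m + if z i = true then 2 else 0 := by
  have hupdate := hammingDist_update_right (fun j => !z j) (fun _ => false) i true
  have hcompl := hammingWeight_add_hammingWeight_not z
  rw [hammingWeight_eq_hammingDist_false (fun j => !z j)] at hcompl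
  cases hz : z i <;>
    simp only [hz, ne_eq, Bool.not_true, Bool.not_false, Bool.false_eq_true, Bool.true_eq_false,
      not_true, not_false_eq_true, if_true, if_false] at hupdate ⊢ <;>
    omega

-- Alice holds `z` followed by its complement, Bob the `i`-th unit vector on the complement.
theorem exists_index_gadget (hn : n = 2 * (m * g) + r) (u v : BitStr r) :
    ∃ (X : BitStr m → BitStr n) (Y : Fin m → BitStr n), ∀ z i,
      hammingWeight (X z) = m * g + hammingWeight u ∧
      hammingWeight (Y i) = g + hammingWeight v ∧
      hammingDist (X z) (Y i) + g =
        m * g + hammingDist u v + if z i = true then 2 * g else 0 := by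
  let e : Fin n ≃ ((Fin m × Fin g) ⊕ (Fin m × Fin g)) ⊕ Fin r :=
    Fintype.equivOfCardEq (by simp; omega)
  refine ⟨fun z => blockString e z (fun j => !z j) u,
    fun i => blockString e (fun _ => false) (Function.update (fun _ => false) i true) v,
    fun z i => ⟨?_, ?_, ?_⟩⟩
  · rw [hammingWeight_blockString, ← add_mul, hammingWeight_add_hammingWeight_not]
  · rw [hammingWeight_blockString, hammingWeight_update_false]
    simp [hammingWeight]
  · have hdist := congrArg (· * g) (hammingWeight_add_hammingDist_not_update z i)
    simp only [add_mul, ite_mul, one_mul, zero_mul] at hdist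
    rw [hammingDist_blockString, ← hammingWeight_eq_hammingDist_false]
    omega

end Gadget

theorem indexEmbeds_exactGHD {A B D E g m n : ℕ} (hg : 0 < g) (hB : m * g ≤ B + g)
    (hE : m * g ≤ E + g) (hn : n = A + B + D + E + 2 * g) :
    IndexEmbeds m (exactGHD n (A + B + g) (A + D + g) (B + D + g) g) := by
  obtain ⟨B', hB'⟩ := Nat.exists_eq_add_of_le hB
  obtain ⟨E', hE'⟩ := Nat.exists_eq_add_of_le hE
  obtain ⟨u, v, huv⟩ := exists_bitStr_hasJointType A B' D E'
  obtain ⟨X, Y, hXY⟩ := exists_index_gadget (m := m) (g := g) (n := n) (by omega) u v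
  refine ⟨X, Y, fun z i => ?_⟩
  obtain ⟨hX, hY, hdist⟩ := hXY z i
  rw [huv.weight_left] at hX
  rw [huv.weight_right] at hY
  rw [huv.dist_eq] at hdist
  rw [exactGHD, if_pos ⟨by omega, by omega⟩]
  cases hz : z i <;> simp only [hz, Bool.false_eq_true, if_false, if_true] at hdist
  · rw [if_neg (by omega), if_pos (by omega)]
  · rw [if_pos (by omega)]

theorem lt_mul_of_forall_le {N K g : ℕ} (hg : 0 < g) (h : ∀ m, m * g ≤ N + g → m ≤ K) :
    N < K * g := by
  have hle : (N / g + 1) * g ≤ N + g := by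
    rw [add_one_mul]
    exact Nat.add_le_add_right (Nat.div_mul_le_self N g) g
  calc N < (N / g + 1) * g := (Nat.lt_mul_div_succ N hg).trans_eq (mul_comm _ _)
    _ ≤ K * g := Nat.mul_le_mul_right g (h _ hle)

theorem min_rightZeros_lt_mul_oneWayCC {A B D E g n : ℕ} (hg : 0 < g)
    (hn : n = A + B + D + E + 2 * g) :
    min B E < 15 * oneWayCC (exactGHD n (A + B + g) (A + D + g) (B + D + g) g) * g :=
  lt_mul_of_forall_le hg fun _ _ => (indexEmbeds_exactGHD hg (by omega) (by omega) hn).le_oneWayCC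

theorem min_rightOnes_lt_mul_oneWayCC {A B D E g n : ℕ} (hg : 0 < g)
    (hn : n = A + B + D + E + 2 * g) :
    min A D < 15 * oneWayCC (exactGHD n (A + B + g) (A + D + g) (B + D + g) g) * g := by
  refine lt_mul_of_forall_le hg fun m _ => IndexEmbeds.le_oneWayCC ?_
  have hcompl : IndexEmbeds m (exactGHD n (B + A + g) (B + E + g) (A + E + g) g) :=
    indexEmbeds_exactGHD (E := D) hg (by omega) (by omega) (by omega)
  rw [add_comm A B]
  exact hcompl.exactGHD_compl hg (by omega) (by omega)

namespace MeaningfulGHD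

variable {n a b c g : ℕ}

theorem exists_counts (h : MeaningfulGHD n a b c g) :
    ∃ A B D E : ℕ, n = A + B + D + E + 2 * g ∧ a = A + B + g ∧ b = A + D + g ∧
      c = B + D + g := by
  obtain ⟨-, -, -, ⟨x, y, hx, hy, hxy⟩, ⟨u, v, hu, hv, huv⟩⟩ := h
  obtain ⟨A, q, r, E, hfar⟩ := exists_hasJointType x y
  obtain ⟨p, B, D, s, hnear⟩ := exists_hasJointType u v
  obtain ⟨hn, hx', hy', hxy'⟩ := hfar
  obtain ⟨hn', hu', hv', huv'⟩ := hnear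
  exact ⟨A, B, D, E, by omega, by omega, by omega, by omega⟩

theorem swap (h : MeaningfulGHD n a b c g) : MeaningfulGHD n b a c g := by
  obtain ⟨hg, ha, hb, ⟨x, y, hx, hy, hxy⟩, ⟨u, v, hu, hv, huv⟩⟩ := h
  exact ⟨hg, hb, ha, ⟨y, x, hy, hx, by rwa [hammingDist_comm]⟩,
    ⟨v, u, hv, hu, by rwa [hammingDist_comm]⟩⟩

theorem gap_le_min (h : MeaningfulGHD n a b c g) :
    g ≤ min (min a (n - a)) (min c (n - c)) := by
  obtain ⟨A, B, D, E, hn, ha, hb, hc⟩ := h.exists_counts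
  omega

theorem min_le_mul_oneWayCC (h : MeaningfulGHD n a b c g) :
    min (min a (n - a)) (min c (n - c)) ≤ 45 * oneWayCC (exactGHD n a b c g) * g := by
  have hg := h.1
  obtain ⟨A, B, D, E, hn, rfl, rfl, rfl⟩ := h.exists_counts
  have hBE := min_rightZeros_lt_mul_oneWayCC hg hn
  have hAD := min_rightOnes_lt_mul_oneWayCC hg hn
  set R := oneWayCC (exactGHD n (A + B + g) (A + D + g) (B + D + g) g)
  have hR : g ≤ R * g := Nat.le_mul_of_pos_left g (Nat.pos_of_ne_zero fun h0 => by simp [h0] at hBE)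
  rw [mul_assoc] at hBE hAD ⊢
  omega

theorem oneWayCC_pos (h : MeaningfulGHD n a b c g) : 0 < oneWayCC (exactGHD n a b c g) := by
  have := h.1.trans_le (h.gap_le_min.trans h.min_le_mul_oneWayCC)
  exact Nat.pos_of_ne_zero fun h0 => by simp [h0] at this

theorem min_distance_le_add (h : MeaningfulGHD n a b c g) :
    min c (n - c) ≤ min (min a (n - a)) (min c (n - c)) +
      min (min b (n - b)) (min c (n - c)) := by
  obtain ⟨A, B, D, E, hn, ha, hb, hc⟩ := h.exists_counts
  omega

theorem min_le_two_pow_oneWayCC (h : MeaningfulGHD n a b c g) :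
    min c (n - c) ≤ 90 * 2 ^ oneWayCC (exactGHD n a b c g) * g := by
  have hBob : oneWayCC (exactGHD n b a c g) ≤ 2 ^ oneWayCC (exactGHD n a b c g) := by
    rw [← exactGHD_swap]
    exact oneWayCC_swap_le_two_pow _
  calc min c (n - c)
      ≤ 45 * oneWayCC (exactGHD n a b c g) * g + 45 * oneWayCC (exactGHD n b a c g) * g :=
        h.min_distance_le_add.trans
          (Nat.add_le_add h.min_le_mul_oneWayCC h.swap.min_le_mul_oneWayCC)
    _ ≤ 45 * 2 ^ oneWayCC (exactGHD n a b c g) * g +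
          45 * 2 ^ oneWayCC (exactGHD n a b c g) * g := by
        gcongr
        exact Nat.lt_two_pow_self.le
    _ = 90 * 2 ^ oneWayCC (exactGHD n a b c g) * g := by ring

end MeaningfulGHD

end ExactGHD

theorem logb_two_le_add_seven {q : ℝ} {R : ℕ} (hq : 0 < q) (h : q ≤ 90 * 2 ^ R) :
    Real.logb 2 q ≤ R + 7 := by
  have hpow : q ≤ 2 ^ (R + 7) := h.trans (by rw [pow_add]; nlinarith [pow_pos (two_pos (α := ℝ)) R])
  calc Real.logb 2 q ≤ Real.logb 2 (2 ^ (R + 7)) := Real.logb_le_logb_of_le one_lt_two hq hpow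
    _ = R + 7 := by rw [Real.logb_pow, Real.logb_self_eq_one one_lt_two]; push_cast; ring

theorem mainTheorem10 :
    ∃ C : ℝ, 0 < C ∧ ∀ n a b c g : ℕ, MeaningfulGHD n a b c g →
      (1 / C) * (min (min (a : ℝ) ((n : ℝ) - a)) (min (c : ℝ) ((n : ℝ) - c)) / g)
          ≤ (oneWayCC (exactGHD n a b c g) : ℝ) ∧
      (1 / C) * Real.logb 2 (min (c : ℝ) ((n : ℝ) - c) / g)
          ≤ (oneWayCC (exactGHD n a b c g) : ℝ) := by
  refine ⟨45, by norm_num, fun n a b c g h => ?_⟩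
  have hg : (0 : ℝ) < g := by exact_mod_cast h.1
  have hR : (1 : ℝ) ≤ oneWayCC (exactGHD n a b c g) := by exact_mod_cast h.oneWayCC_pos
  have hmin : 0 < min c (n - c) := h.1.trans_le (h.gap_le_min.trans (min_le_right _ _))
  rw [← Nat.cast_sub h.2.1, ← Nat.cast_sub (by omega : c ≤ n), ← Nat.cast_min, ← Nat.cast_min,
    ← Nat.cast_min]
  constructor
  · have hlinear : ((min (min a (n - a)) (min c (n - c)) : ℕ) : ℝ) / g ≤
        45 * oneWayCC (exactGHD n a b c g) :=
      (div_le_iff₀ hg).2 (by exact_mod_cast h.min_le_mul_oneWayCC)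
    linarith
  · have hexp : ((min c (n - c) : ℕ) : ℝ) / g ≤ 90 * 2 ^ oneWayCC (exactGHD n a b c g) :=
      (div_le_iff₀ hg).2 (by exact_mod_cast h.min_le_two_pow_oneWayCC)
    have hpos : (0 : ℝ) < (min c (n - c) : ℕ) / g :=
      div_pos (by exact_mod_cast hmin) hg
    linarith [logb_two_le_add_seven hpos hexp]
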